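/- Notation. A simple $k$-uniform hypergraph $H=(V,E)$ has as hyperedges distinct $k$-element subsets of $V$. For a permutation $\pi$ of $V$ let $\mathrm{AUT}(H;\pi)=|\{e\in E:\pi(e)\in E\}|/|E|$. $H$ is $(\beta,\gamma)$-asymmetric if $\mathrm{AUT}(H;\pi)<1-\gamma$ for every permutation $\pi$ of $V$ that has at most $(1-\beta)|V|$ fixed points. For $m\le\binom nk$, $\mathcal G^{(k)}_{n,m}$ is the uniform distribution over all $\binom{\binom nk}{m}$ simple $k$-uniform hypergraphs with $n$ labelled vertices and $m$ hyperedges. Theorem. For every constant $k$ there is a constant $\kappa_k>0$, depending only on $k$, with the following property: for all sufficiently large $n$ (the threshold depending only on $k$ and $\kappa_k$) and all $m=cn$ such that $c\ge\kappa_k$ and $m\le\binom nk/\kappa_k^3$, if $\beta^*=\max\{e^{-c/6},1/n\}$, then with probability at least $1-n^{-15}$ a random hypergraph $H$ drawn from $\mathcal G^{(k)}_{n,m}$ is $(\beta,\beta/240)$-asymmetric simultaneously for all $\beta$ with $\beta^*\le\beta\le1$. For $k=3$, the value $\kappa_3=10^4$ has this property. -/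

import Mathlib

/-- A simple `k`-uniform hypergraph on the vertex set `V`: a finite set of hyperedges, each of
which is a set of exactly `k` vertices. -/
@[ext]
structure UniformHypergraph (V : Type*) (k : ℕ) where
  edges : Finset (Finset V)
  uniform : ∀ e ∈ edges, e.card = k

namespace UniformHypergraph

variable {V : Type*} [DecidableEq V] {k : ℕ}

/-- `GI(G, H; π)`: the fraction `|{e ∈ E(G) : π(e) ∈ E(H)}| / max(|E(G)|, |E(H)|)` of hyperedges
satisfied by the bijection `π`. -/
noncomputable def gi {W : Type*} [DecidableEq W] (G : UniformHypergraph V k)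
    (H : UniformHypergraph W k) (π : V ≃ W) : ℝ :=
  ((G.edges.filter fun e => e.map π.toEmbedding ∈ H.edges).card : ℝ) /
    (max G.edges.card H.edges.card : ℕ)

/-- `AUT(G; π) = GI(G, G; π)`. -/
noncomputable def aut (G : UniformHypergraph V k) (π : Equiv.Perm V) : ℝ :=
  G.gi G π

/-- `(β, γ)`-asymmetry: every permutation of the vertices for which at most a `1 - β` fraction of
the vertices are fixed points satisfies `AUT(G; π) < 1 - γ`. -/
def IsAsymmetric [Fintype V] (G : UniformHypergraph V k) (β γ : ℝ) : Prop :=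
  ∀ π : Equiv.Perm V,
    ((Finset.univ.filter fun v => π v = v).card : ℝ) ≤ (1 - β) * Fintype.card V →
      G.aut π < 1 - γ

instance instFinite (V : Type*) [Finite V] (k : ℕ) : Finite (UniformHypergraph V k) :=
  Finite.of_injective UniformHypergraph.edges fun _ _ h => UniformHypergraph.ext h

/-- The set of all simple `k`-uniform hypergraphs on `n` labelled vertices with exactly `m`
hyperedges. -/
noncomputable def withEdges (n k m : ℕ) : Finset (UniformHypergraph (Fin n) k) :=
  (Set.toFinite {G : UniformHypergraph (Fin n) k | G.edges.card = m}).toFinset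

theorem mem_withEdges {n k m : ℕ} {G : UniformHypergraph (Fin n) k} :
    G ∈ withEdges n k m ↔ G.edges.card = m := by
  simp [withEdges]

theorem card_withEdges (n k m : ℕ) : (withEdges n k m).card = (n.choose k).choose m := by
  have h : (withEdges n k m).card =
      (Finset.powersetCard m (Finset.powersetCard k (Finset.univ : Finset (Fin n)))).card := by
    refine Finset.card_bij (fun G _ => G.edges) ?_ ?_ ?_
    · intro G hG
      rw [Finset.mem_powersetCard]
      refine ⟨fun e he => ?_, mem_withEdges.1 hG⟩
      rw [Finset.mem_powersetCard]
      exact ⟨Finset.subset_univ e, G.uniform e he⟩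
    · intro G _ G' _ h
      exact UniformHypergraph.ext h
    · intro E hE
      rw [Finset.mem_powersetCard] at hE
      exact ⟨⟨E, fun e he => (Finset.mem_powersetCard.1 (hE.1 he)).2⟩,
        mem_withEdges.2 hE.2, rfl⟩
  rw [h, Finset.card_powersetCard, Finset.card_powersetCard, Finset.card_univ, Fintype.card_fin]

theorem withEdges_nonempty {n k m : ℕ} (hm : m ≤ n.choose k) : (withEdges n k m).Nonempty := by
  rw [← Finset.card_pos, card_withEdges]
  exact Nat.choose_pos hm

/-- The random hypergraph model `G^{(k)}_{n,m}`: the uniform distribution over all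
`C(C(n,k), m)` simple `k`-uniform hypergraphs with `n` vertices and `m` hyperedges (there is such a
hypergraph exactly when `m ≤ C(n,k)`). -/
noncomputable def randomHypergraph (n k m : ℕ) (hm : m ≤ n.choose k) :
    PMF (UniformHypergraph (Fin n) k) :=
  PMF.uniformOfFinset (withEdges n k m) (withEdges_nonempty hm)

/-- `κ` is an admissible constant for uniformity `k`: for all sufficiently large `n` (the threshold
depends only on `k` and `κ`) and all `c`, `m` with `m = c n`, `κ ≤ c` and `m ≤ C(n,k) / κ³`, with
probability at least `1 - n^{-15}` a random hypergraph from `G^{(k)}_{n,m}` is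
`(β, β/240)`-asymmetric simultaneously for all `β` with `max {exp (-c/6), 1/n} ≤ β ≤ 1`. -/
def IsRobustAsymmetryConstant (k : ℕ) (κ : ℝ) : Prop :=
  ∃ N : ℕ, ∀ n : ℕ, N ≤ n → ∀ (c : ℝ) (m : ℕ) (hm : m ≤ n.choose k),
    (m : ℝ) = c * n → κ ≤ c → (m : ℝ) ≤ (n.choose k : ℝ) / κ ^ 3 →
      ENNReal.ofReal (1 - 1 / (n : ℝ) ^ 15) ≤
        (randomHypergraph n k m hm).toOuterMeasure
          {H | ∀ β : ℝ, max (Real.exp (-c / 6)) (1 / (n : ℝ)) ≤ β → β ≤ 1 →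
            H.IsAsymmetric β (β / 240)}

end UniformHypergraph

open Finset

/-! Fix `π` with support T, and let t = |T| and x = ct. By `lt_card_filter_map_notMem`, `π` breaks
more than x/240 hyperedges unless (1) at most 0.05x hyperedges meet T, (2) at least 0.01x hyperedges
contain some moved v together with `π v`, or (3) some ⌈0.0119x⌉ hyperedges meeting T form a set S
disjoint from its image, with S and its image both present. Indeed, a hyperedge that meets T and
contains no moved pair is not fixed by `π`; if enough of these are mapped to hyperedges, a third of
them can be chosen disjoint from their images.

Event (1) has probability exp(-Ω(x)). This cannot pay for n^t permutations when c is constant, but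
the event depends only on T, and t ≥ n exp(-c/6) keeps log C(n,t) below about x/6 + t. Events (2)
and (3) have probability at most n^(-(t+17)), enough for all n^t permutations: moved pairs have
density O(tk²/n²), and (3) prescribes twice |S| hyperedges at low density. Every support size thus
contributes at most n^(-17) per event. Since the union bound runs over `π` and T, the conclusion
holds for all β at once. -/

theorem Nat.choose_mul_pow_le_pow_mul_choose {R N : ℕ} (h : R ≤ N) (i : ℕ) :
    R.choose i * N ^ i ≤ R ^ i * N.choose i := by
  induction i with
  | zero => simp
  | succ i ih =>
    have h1 := Nat.choose_succ_right_eq R i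
    have h2 := Nat.choose_succ_right_eq N i
    have h3 : (R - i) * N ≤ R * (N - i) := by
      rw [Nat.sub_mul, Nat.mul_sub]
      have := Nat.mul_le_mul_left i h
      have e : R * i = i * R := Nat.mul_comm _ _
      omega
    refine Nat.le_of_mul_le_mul_right ?_ (Nat.succ_pos i)
    calc R.choose (i + 1) * N ^ (i + 1) * (i + 1)
        = (R.choose (i + 1) * (i + 1)) * N ^ i * N := by ring
      _ = (R.choose i * N ^ i) * ((R - i) * N) := by rw [h1]; ring
      _ ≤ (R ^ i * N.choose i) * (R * (N - i)) := Nat.mul_le_mul ih h3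
      _ = R ^ (i + 1) * (N.choose i * (N - i)) := by ring
      _ = R ^ (i + 1) * N.choose (i + 1) * (i + 1) := by rw [← h2]; ring

/-- Each factor (R - l)/(N - l) of the ratio of binomials is at most R/N: sampling without
replacement is dominated by sampling with replacement. All three probability estimates rest on this.
-/
theorem Nat.cast_choose_le_div_pow_mul_choose {R N : ℕ} (h : R ≤ N) (i : ℕ) :
    (R.choose i : ℝ) ≤ ((R : ℝ) / N) ^ i * N.choose i := by
  rcases Nat.eq_zero_or_pos N with rfl | hN
  · obtain rfl : R = 0 := by omega
    cases i <;> simp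
  · have := Nat.choose_mul_pow_le_pow_mul_choose h i
    rw [div_pow, div_mul_eq_mul_div, le_div_iff₀ (by positivity)]
    exact_mod_cast this

/-! ### Random m-element subsets of a finite set -/

namespace Finset

variable {α : Type*} [DecidableEq α]

theorem card_powersetCard_filter_superset {Ω S : Finset α} (hS : S ⊆ Ω) {m : ℕ}
    (hm : #S ≤ m) :
    #{E ∈ Ω.powersetCard m | S ⊆ E} = (#Ω - #S).choose (m - #S) := by
  rw [← card_sdiff_of_subset hS, ← card_powersetCard]
  refine card_bij' (fun E _ => E \ S) (fun E _ => E ∪ S) ?_ ?_ ?_ ?_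
  · intro E hE
    simp only [mem_filter, mem_powersetCard] at hE ⊢
    exact ⟨sdiff_subset_sdiff hE.1.1 le_rfl, by rw [card_sdiff_of_subset hE.2, hE.1.2]⟩
  · intro E hE
    simp only [mem_filter, mem_powersetCard] at hE ⊢
    refine ⟨⟨union_subset (hE.1.trans sdiff_subset) hS, ?_⟩, subset_union_right⟩
    rw [card_union_of_disjoint (disjoint_of_subset_left hE.1 sdiff_disjoint), hE.2]
    omega
  · intro E hE
    simp only [mem_filter] at hE
    exact sdiff_union_of_subset hE.2
  · intro E hE
    simp only [mem_powersetCard] at hE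
    exact union_sdiff_cancel_right (disjoint_of_subset_left hE.1 sdiff_disjoint)

/-- A fixed set `S` is contained in a uniformly random `m`-element subset of `Ω` with probability
at most `(m / #Ω) ^ #S`. -/
theorem card_powersetCard_filter_superset_le {Ω S : Finset α} (hS : S ⊆ Ω) {m : ℕ}
    (hm : m ≤ #Ω) :
    (#{E ∈ Ω.powersetCard m | S ⊆ E} : ℝ) ≤ ((m : ℝ) / #Ω) ^ #S * (#Ω).choose m := by
  by_cases h : #S ≤ m
  · rw [card_powersetCard_filter_superset hS h]
    have h1 := Nat.choose_mul (n := #Ω) h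
    have h2 := Nat.cast_choose_le_div_pow_mul_choose hm #S
    have h3 : (0 : ℝ) < (#Ω).choose #S := by exact_mod_cast Nat.choose_pos (card_le_card hS)
    have h1' : ((#Ω).choose m : ℝ) * m.choose #S
        = (#Ω).choose #S * (#Ω - #S).choose (m - #S) := by exact_mod_cast h1
    refine le_of_mul_le_mul_left ?_ h3
    rw [← h1']
    calc ((#Ω).choose m : ℝ) * m.choose #S
        ≤ (#Ω).choose m * (((m : ℝ) / #Ω) ^ #S * (#Ω).choose #S) := by gcongr
      _ = _ := by ring
  · have : {E ∈ Ω.powersetCard m | S ⊆ E} = ∅ := by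
      refine filter_eq_empty_iff.2 fun E hE hSE => h ?_
      rw [← (mem_powersetCard.1 hE).2]
      exact card_le_card hSE
    rw [this]
    simp only [card_empty, Nat.cast_zero]
    positivity

/-- The moment generating function of a hypergeometric variable is at most the one of the
binomial variable with the same mean. -/
theorem sum_powersetCard_pow_card_inter_le {Ω R : Finset α} (hR : R ⊆ Ω) {m : ℕ}
    {z : ℝ} (hz : 1 ≤ z) :
    ∑ E ∈ Ω.powersetCard m, z ^ #(E ∩ R)
      ≤ (1 + (z - 1) * ((#R : ℝ) / #Ω)) ^ m * (#Ω).choose m := by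
  have hz0 : 0 ≤ z - 1 := by linarith
  -- Write z as 1 + (z - 1) and expand over subsets S of E ∩ R. After exchanging sums, each S is
  -- weighted by the number of E containing it, and nonnegativity of z - 1 allows a termwise
  -- comparison with the binomial expansion.
  have expand : ∀ E ∈ Ω.powersetCard m, z ^ #(E ∩ R)
      = ∑ S ∈ R.powerset, if S ⊆ E then (z - 1) ^ #S else 0 := by
    intro E _
    rw [← sum_filter]
    have : {S ∈ R.powerset | S ⊆ E} = (E ∩ R).powerset := by
      ext S; simp only [mem_filter, mem_powerset, subset_inter_iff]; tauto
    rw [this, sum_powerset_apply_card (fun i => (z - 1) ^ i)]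
    have := add_pow (z - 1) 1 #(E ∩ R)
    rw [sub_add_cancel] at this
    rw [this]
    refine sum_congr rfl fun i _ => ?_
    simp [nsmul_eq_mul, mul_comm]
  rw [sum_congr rfl expand, sum_comm]
  have inner : ∀ S ∈ R.powerset, (∑ E ∈ Ω.powersetCard m, if S ⊆ E then (z - 1) ^ #S else 0)
      = (z - 1) ^ #S * if #S ≤ m then ((#Ω - #S).choose (m - #S) : ℝ) else 0 := by
    intro S hS
    rw [← sum_filter, sum_const, nsmul_eq_mul, mul_comm]
    congr 1
    split_ifs with h
    · rw [card_powersetCard_filter_superset ((mem_powerset.1 hS).trans hR) h]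
    · have : {E ∈ Ω.powersetCard m | S ⊆ E} = ∅ := by
        refine filter_eq_empty_iff.2 fun E hE hSE => h ?_
        rw [← (mem_powersetCard.1 hE).2]
        exact card_le_card hSE
      simp [this]
  rw [sum_congr rfl inner, sum_powerset_apply_card
    (fun i => (z - 1) ^ i * if i ≤ m then ((#Ω - i).choose (m - i) : ℝ) else 0)]
  have key : ∀ i, (#R).choose i • ((z - 1) ^ i * if i ≤ m then ((#Ω - i).choose (m - i) : ℝ) else 0)
      ≤ if i ∈ range (m + 1) then
        ((z - 1) * ((#R : ℝ) / #Ω)) ^ i * 1 ^ (m - i) * m.choose i * (#Ω).choose m else 0 := by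
    intro i
    by_cases h : i ≤ m
    · have hi : i ∈ range (m + 1) := by simp; omega
      rw [if_pos h, if_pos hi, nsmul_eq_mul, one_pow, mul_one, mul_pow]
      have h1 : ((#Ω).choose m : ℝ) * m.choose i
          = (#Ω).choose i * (#Ω - i).choose (m - i) := by exact_mod_cast Nat.choose_mul h
      have h2 := Nat.cast_choose_le_div_pow_mul_choose (card_le_card hR) i
      calc ((#R).choose i : ℝ) * ((z - 1) ^ i * (#Ω - i).choose (m - i))
          ≤ (((#R : ℝ) / #Ω) ^ i * (#Ω).choose i) * ((z - 1) ^ i * (#Ω - i).choose (m - i)) := by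
            gcongr
        _ = (z - 1) ^ i * ((#R : ℝ) / #Ω) ^ i * ((#Ω).choose i * (#Ω - i).choose (m - i)) := by
            ring
        _ = _ := by rw [← h1]; ring
    · have hi : i ∉ range (m + 1) := by simp; omega
      simp [h, hi]
  refine (sum_le_sum fun i _ => key i).trans ?_
  rw [add_comm (1 : ℝ), add_pow, sum_mul, ← sum_filter]
  refine sum_le_sum_of_subset_of_nonneg (fun i hi => (mem_filter.1 hi).2) fun i _ _ => ?_
  positivity

/-- Chernoff's bound: Markov's inequality for z^|E ∩ R|. -/
theorem card_filter_le_card_inter_le {Ω R : Finset α} (hR : R ⊆ Ω) {m : ℕ}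
    {z s : ℝ} (hz : 1 ≤ z) :
    (#{E ∈ Ω.powersetCard m | s ≤ (#(E ∩ R) : ℝ)} : ℝ)
      ≤ (1 + (z - 1) * ((#R : ℝ) / #Ω)) ^ m * z ^ (-s) * (#Ω).choose m := by
  have hz0 : 0 < z := by linarith
  have h := sum_powersetCard_pow_card_inter_le hR (m := m) hz
  have h2 : (#{E ∈ Ω.powersetCard m | s ≤ (#(E ∩ R) : ℝ)} : ℝ) * z ^ s
      ≤ ∑ E ∈ Ω.powersetCard m, z ^ #(E ∩ R) := by
    calc _ = ∑ E ∈ Ω.powersetCard m with s ≤ (#(E ∩ R) : ℝ), z ^ s := by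
          rw [sum_const, nsmul_eq_mul]
      _ ≤ ∑ E ∈ Ω.powersetCard m with s ≤ (#(E ∩ R) : ℝ), z ^ #(E ∩ R) := by
          refine sum_le_sum fun E hE => ?_
          rw [← Real.rpow_natCast]
          exact Real.rpow_le_rpow_of_exponent_le hz (mem_filter.1 hE).2
      _ ≤ _ := sum_le_sum_of_subset_of_nonneg (filter_subset _ _) fun _ _ _ => by positivity
  rw [← le_div_iff₀ (Real.rpow_pos_of_pos hz0 s)] at h2
  refine h2.trans ?_
  rw [Real.rpow_neg hz0.le, div_eq_mul_inv, mul_right_comm]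
  gcongr

/-- A set of non-fixed points of an injective map contains a subset of a third of its size that is
disjoint from its image. -/
theorem exists_subset_disjoint_image {f : α → α} (hf : f.Injective) (S₀ : Finset α)
    (h : ∀ e ∈ S₀, f e ≠ e) :
    ∃ S ⊆ S₀, #S₀ ≤ 3 * #S ∧ Disjoint S (S.image f) := by
  -- Take S of maximal size. An element outside S, its image and its preimage could be added, so
  -- these three sets, each of size at most |S|, cover `S₀`.
  obtain ⟨S, hS, hmax⟩ := exists_max_image {S ∈ S₀.powerset | Disjoint S (S.image f)} card
    ⟨∅, by simp⟩
  simp only [mem_filter, mem_powerset] at hS hmax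
  refine ⟨S, hS.1, ?_, hS.2⟩
  have cover : S₀ ⊆ (S ∪ S.image f) ∪ {e ∈ S₀ | f e ∈ S} := by
    intro e he
    by_contra hcon
    simp only [mem_union, mem_filter, not_or, not_and] at hcon
    obtain ⟨⟨h1, h2⟩, h3⟩ := hcon
    have := hmax (insert e S) ⟨insert_subset he hS.1, by
      rw [image_insert, disjoint_insert_left, disjoint_insert_right]
      refine ⟨?_, h3 he, hS.2⟩
      rw [mem_insert, not_or]
      exact ⟨(h e he).symm, h2⟩⟩
    rw [card_insert_of_notMem h1] at this
    omega
  have h1 := card_le_card cover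
  have h2 := card_union_le (S ∪ S.image f) {e ∈ S₀ | f e ∈ S}
  have h3 := card_union_le S (S.image f)
  have h4 : #(S.image f) ≤ #S := card_image_le
  have h5 : #{e ∈ S₀ | f e ∈ S} ≤ #S :=
    card_le_card_of_injOn f (fun e he => (mem_filter.1 he).2) hf.injOn
  omega

/-- Union bound over S; disjointness and injectivity give S ∪ f(S) exactly 2j elements. -/
theorem card_filter_exists_disjoint_pair_le {Ω B : Finset α} (hB : B ⊆ Ω) {f : α → α}
    (hf : f.Injective) (hfΩ : ∀ e ∈ Ω, f e ∈ Ω) {m : ℕ} (hm : m ≤ #Ω) (j : ℕ) :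
    (#{E ∈ Ω.powersetCard m | ∃ S ∈ B.powersetCard j,
        Disjoint S (S.image f) ∧ S ∪ S.image f ⊆ E} : ℝ)
      ≤ (#B).choose j * ((m : ℝ) / #Ω) ^ (2 * j) * (#Ω).choose m := by
  have hsub : {E ∈ Ω.powersetCard m | ∃ S ∈ B.powersetCard j,
        Disjoint S (S.image f) ∧ S ∪ S.image f ⊆ E}
      ⊆ {S ∈ B.powersetCard j | Disjoint S (S.image f)}.biUnion
        fun S => {E ∈ Ω.powersetCard m | S ∪ S.image f ⊆ E} := by
    intro E hE
    obtain ⟨hE, S, hS, hd, hSE⟩ := mem_filter.1 hE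
    exact mem_biUnion.2 ⟨S, mem_filter.2 ⟨hS, hd⟩, mem_filter.2 ⟨hE, hSE⟩⟩
  have h1 : (#{E ∈ Ω.powersetCard m | ∃ S ∈ B.powersetCard j,
        Disjoint S (S.image f) ∧ S ∪ S.image f ⊆ E} : ℝ)
      ≤ ∑ S ∈ B.powersetCard j with Disjoint S (S.image f),
        (#{E ∈ Ω.powersetCard m | S ∪ S.image f ⊆ E} : ℝ) := by
    exact_mod_cast (card_le_card hsub).trans card_biUnion_le
  refine h1.trans ?_
  have h2 : ∀ S ∈ {S ∈ B.powersetCard j | Disjoint S (S.image f)},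
      (#{E ∈ Ω.powersetCard m | S ∪ S.image f ⊆ E} : ℝ)
        ≤ ((m : ℝ) / #Ω) ^ (2 * j) * (#Ω).choose m := by
    intro S hS
    obtain ⟨hS, hd⟩ := mem_filter.1 hS
    obtain ⟨hSB, hSj⟩ := mem_powersetCard.1 hS
    have hc : #(S ∪ S.image f) = 2 * j := by
      rw [card_union_of_disjoint hd, card_image_of_injective _ hf, hSj]; ring
    rw [← hc]
    refine card_powersetCard_filter_superset_le (union_subset (hSB.trans hB) ?_) hm
    exact image_subset_iff.2 fun e he => hfΩ e (hB (hSB he))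
  refine (sum_le_card_nsmul _ _ _ h2).trans ?_
  rw [nsmul_eq_mul, mul_assoc]
  gcongr
  rw [← card_powersetCard]
  exact card_le_card (filter_subset _ _)

end Finset

/-! ### Counting permutations by support -/

theorem Equiv.Perm.card_filter_support_eq_le {V : Type*} [Fintype V] [DecidableEq V]
    (T : Finset V) : #{π : Equiv.Perm V | π.support = T} ≤ (#T).factorial := by
  have h : Fintype.card (Equiv.Perm {x // x ∈ T}) = (#T).factorial := by
    rw [Fintype.card_perm, Fintype.card_coe]
  rw [← h, Fintype.card_congr (Equiv.Perm.subtypeEquivSubtypePerm (· ∈ T)), ← Fintype.card_coe]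
  refine Fintype.card_le_of_injective
    (fun π => ⟨π.1, fun a ha => by
      have := (mem_filter.1 π.2).2
      rw [← this] at ha
      simpa using ha⟩) ?_
  intro a b hab
  exact Subtype.ext (congrArg (fun x => x.1) hab)

theorem Equiv.Perm.card_filter_card_support_eq_le (n t : ℕ) :
    #{π : Equiv.Perm (Fin n) | #π.support = t} ≤ n ^ t := by
  have hsub : ({π : Equiv.Perm (Fin n) | #π.support = t} : Finset _)
      ⊆ (powersetCard t univ).biUnion fun T => {π : Equiv.Perm (Fin n) | π.support = T} := by
    intro π hπ
    simp only [mem_biUnion, mem_filter, mem_powersetCard, mem_univ, true_and] at hπ ⊢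
    exact ⟨π.support, ⟨subset_univ _, hπ⟩, rfl⟩
  calc _ ≤ ∑ T ∈ powersetCard t (univ : Finset (Fin n)),
        #{π : Equiv.Perm (Fin n) | π.support = T} := (card_le_card hsub).trans card_biUnion_le
    _ ≤ ∑ T ∈ powersetCard t (univ : Finset (Fin n)), t.factorial := by
        refine sum_le_sum fun T hT => ?_
        rw [← (mem_powersetCard.1 hT).2]
        exact Equiv.Perm.card_filter_support_eq_le T
    _ = t.factorial * n.choose t := by simp [mul_comm]
    _ = n.descFactorial t := (Nat.descFactorial_eq_factorial_mul_choose n t).symm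
    _ ≤ n ^ t := Nat.descFactorial_le_pow n t

/-! ### Numerical estimates for the union bound -/

theorem Nat.cast_choose_le_exp_mul_div_pow (n t : ℕ) (ht : 0 < t) :
    (n.choose t : ℝ) ≤ (Real.exp 1 * n / t) ^ t := by
  have h1 := Nat.choose_le_pow_div (α := ℝ) t n
  have h2 := Real.pow_div_factorial_le_exp (t : ℝ) (by positivity) t
  have ht' : (0 : ℝ) < t := by exact_mod_cast ht
  refine h1.trans ?_
  rw [div_pow, mul_pow, ← Real.exp_nat_mul, mul_one]
  rw [div_le_div_iff₀ (by positivity) (by positivity)]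
  rw [div_le_iff₀ (by positivity)] at h2
  calc (n : ℝ) ^ t * t ^ t ≤ n ^ t * (Real.exp t * t.factorial) := by gcongr
    _ = _ := by ring

/-- Event (1), summed over supports of size t. The last hypothesis gives log(n/t) ≤ c/6, which is
why β* involves exp(-c/6). -/
theorem choose_mul_exp_le_exp_neg_log {n t : ℕ} {c : ℝ} (hL : 40 ≤ Real.log n)
    (hn : (10 : ℝ) ^ 4 ≤ n) (hc : 10 ^ 4 ≤ c) (ht : 2 ≤ t) (htn : t ≤ n)
    (hβ : n * Real.exp (-c / 6) ≤ t) :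
    (n.choose t : ℝ) * Real.exp (0.15 * (c * t) - 0.95 * (c * t) * (2 - t / n))
      ≤ Real.exp (-(17 * Real.log n)) := by
  have hn0 : (0 : ℝ) < n := by linarith
  have ht2 : (2 : ℝ) ≤ t := by exact_mod_cast ht
  have ht0 : (0 : ℝ) < t := by linarith
  have hlog : Real.log n - Real.log t ≤ c / 6 := by
    have := Real.log_le_log (by positivity) hβ
    rw [Real.log_mul hn0.ne' (Real.exp_pos _).ne', Real.log_exp] at this
    linarith
  have hch : (n.choose t : ℝ) ≤ Real.exp (t * (Real.log n - Real.log t + 1)) := by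
    refine (Nat.cast_choose_le_exp_mul_div_pow n t (by omega)).trans (le_of_eq ?_)
    rw [Real.exp_nat_mul, Real.exp_add, Real.exp_sub, Real.exp_log hn0, Real.exp_log ht0]
    congr 1; ring
  have htn' : (t : ℝ) / n ≤ 1 := by
    rw [div_le_one hn0]; exact_mod_cast htn
  set L := Real.log n
  set b : ℝ := t / n
  have hct : 0 ≤ c * t := by positivity
  calc _ ≤ Real.exp (t * (L - Real.log t + 1))
        * Real.exp (0.15 * (c * t) - 0.95 * (c * t) * (2 - b)) := by gcongr
    _ = Real.exp (t * (L - Real.log t + 1) + (0.15 * (c * t) - 0.95 * (c * t) * (2 - b))) :=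
        (Real.exp_add _ _).symm
    _ ≤ _ := by
        apply Real.exp_le_exp.2
        have h1 : t * (L - Real.log t + 1) ≤ t * (c * (1 / 6 + 0.0001)) := by
          gcongr; linarith
        -- Here 1.58 < 1.9 - 0.15 - (1/6 + 0.0001).
        suffices h : 17 * L ≤ c * t * (1.58 - 0.95 * b) by nlinarith
        -- For t ≥ 17, either c ≥ 2L suffices or t ≥ log t ≥ L - c/6 > 2L/3. For small t, c ≥ 6(L -
        -- 3); then t ≥ 2 gives about 18.8 L, just above 17 L.
        by_cases h17 : 17 ≤ t
        · have h17' : (17 : ℝ) ≤ t := by exact_mod_cast h17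
          have h2 : c * t * 0.63 ≤ c * t * (1.58 - 0.95 * b) := by gcongr; linarith
          refine le_trans ?_ h2
          by_cases hcL : 2 * L ≤ c
          · nlinarith
          · have h3 : Real.log t ≤ t := (Real.log_le_sub_one_of_pos ht0).trans (by linarith)
            nlinarith
        · have h17' : (t : ℝ) ≤ 17 := by exact_mod_cast (not_le.1 h17).le
          have hb : b ≤ 0.01 := by
            rw [div_le_iff₀ hn0]; linarith
          have hlt : Real.log t ≤ 3 := by
            rw [Real.log_le_iff_le_exp ht0]
            have : Real.exp 3 = Real.exp 1 ^ 3 := by rw [← Real.exp_nat_mul]; norm_num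
            rw [this]
            have := Real.exp_one_gt_d9
            calc (t : ℝ) ≤ 17 := h17'
              _ ≤ 2.7 ^ 3 := by norm_num
              _ ≤ _ := by gcongr; linarith
          have h2 : c * t * 1.57 ≤ c * t * (1.58 - 0.95 * b) := by gcongr; linarith
          refine le_trans ?_ h2
          have h3 : 6 * (L - 3) ≤ c := by linarith
          nlinarith [hL]

/-- Event (2): L - 2l ≥ L/2, and L ≥ 400 lets half of 0.005L absorb the 1, leaving -0.0025 L ct ≤
-25tL. -/
theorem mul_sub_log_le_neg_log {L l c t : ℝ} (hL : 400 ≤ L) (hl : l ≤ L / 4) (hc : 10 ^ 4 ≤ c)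
    (ht : 2 ≤ t) : c * t - 0.01 * (c * t) * (L - 2 * l) ≤ -((t + 17) * L) := by
  have h1 : 10 ^ 4 * t ≤ c * t := by gcongr
  have h2 : c * t * (0.0025 * L) ≤ c * t * (0.01 * (L - 2 * l) - 1) := by
    gcongr; linarith
  have h3 : 10 ^ 4 * t * (0.0025 * L) ≤ c * t * (0.0025 * L) := by gcongr
  nlinarith

/-- Event (3): C(b,j) ≤ (eb/j)^j, and e/0.0119 < 300. -/
theorem choose_mul_pow_le {b j : ℕ} {k p x : ℝ} (hp : 0 ≤ p) (hk : 0 ≤ k)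
    (hx : 0 < x) (hb : b * p ≤ k * x) (hj : 0.0119 * x ≤ j) :
    (b.choose j : ℝ) * p ^ (2 * j) ≤ (300 * k * p) ^ j := by
  have hj0 : (0 : ℝ) < j := by nlinarith
  have hj0' : 0 < j := by exact_mod_cast hj0
  have h := Nat.cast_choose_le_exp_mul_div_pow b j hj0'
  calc (b.choose j : ℝ) * p ^ (2 * j) ≤ (Real.exp 1 * b / j) ^ j * (p ^ 2) ^ j := by
        rw [pow_mul]; gcongr
    _ = (Real.exp 1 * (b * p) / j * p) ^ j := by rw [← mul_pow]; congr 1; ring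
    _ ≤ (300 * k * p) ^ j := by
        gcongr
        rw [div_le_iff₀ hj0]
        have := Real.exp_one_lt_d9
        calc Real.exp 1 * (b * p) ≤ 2.7182818286 * (k * x) := by gcongr
          _ ≤ 300 * k * (0.0119 * x) := by
            have : 0 ≤ k * x := by positivity
            nlinarith
          _ ≤ 300 * k * j := by gcongr

/-- For c ≥ 800L the exponent j alone is large enough: 9.52t ≥ t + 17 for t ≥ 2. For smaller c the
base must itself be a negative power of n. -/
theorem pow_le_exp_neg_log {j : ℕ} {L c t y : ℝ} (hL : 1 ≤ L) (hc : 10 ^ 4 ≤ c) (ht : 2 ≤ t)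
    (hj : 0.0119 * (c * t) ≤ j) (hy : 0 ≤ y) (hy1 : y ≤ Real.exp (-1))
    (hy2 : c < 800 * L → y ≤ Real.exp (-(L / 2))) :
    y ^ j ≤ Real.exp (-((t + 17) * L)) := by
  by_cases h : c < 800 * L
  · refine (pow_le_pow_left₀ hy (hy2 h) j).trans ?_
    rw [← Real.exp_nat_mul]
    apply Real.exp_le_exp.2
    have h1 : 0.0119 * (10 ^ 4 * t) * (L / 2) ≤ j * (L / 2) := by
      gcongr; exact le_trans (by gcongr) hj
    nlinarith
  · refine (pow_le_pow_left₀ hy hy1 j).trans ?_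
    rw [← Real.exp_nat_mul]
    apply Real.exp_le_exp.2
    have h1 : 0.0119 * (800 * L * t) ≤ j := by
      refine le_trans ?_ hj
      gcongr; linarith
    nlinarith

/-! ### The three bad events and the deterministic reduction -/

namespace UniformHypergraph

/-- The `k`-element subsets of `V` that meet `T`. -/
def edgesMeeting {V : Type*} [Fintype V] [DecidableEq V] (k : ℕ) (T : Finset V) :
    Finset (Finset V) :=
  {e ∈ powersetCard k univ | ¬ Disjoint e T}

/-- The `k`-element subsets of `V` that contain both `v` and `π v` for some `v` moved by `π`. -/
def edgesWithMovedPair {V : Type*} [Fintype V] [DecidableEq V] (k : ℕ) (π : Equiv.Perm V) :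
    Finset (Finset V) :=
  {e ∈ powersetCard k univ | ∃ v ∈ π.support, {v, π v} ⊆ e}

theorem mem_edgesWithMovedPair {V : Type*} [Fintype V] [DecidableEq V] {k : ℕ}
    {π : Equiv.Perm V} {e : Finset V} : e ∈ edgesWithMovedPair k π ↔
      e ∈ powersetCard k univ ∧ ∃ v ∈ π.support, {v, π v} ⊆ e := by
  rw [edgesWithMovedPair, mem_filter]

section Counting

variable {n k m : ℕ}

theorem edgesMeeting_subset (T : Finset (Fin n)) : edgesMeeting k T ⊆ powersetCard k univ :=
  filter_subset _ _

theorem powersetCard_sdiff_edgesMeeting (T : Finset (Fin n)) :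
    powersetCard k univ \ edgesMeeting k T = powersetCard k Tᶜ := by
  ext e
  simp only [edgesMeeting, mem_sdiff, mem_filter, mem_powersetCard, subset_univ, true_and, not_and,
    not_not, subset_compl_iff_disjoint_right]
  tauto

theorem card_powersetCard_univ_fin : #(powersetCard k (univ : Finset (Fin n))) = n.choose k := by
  simp

theorem card_edges_superset_le (hk : k ≤ n) (S : Finset (Fin n)) :
    (#{e ∈ powersetCard k (univ : Finset (Fin n)) | S ⊆ e} : ℝ)
      ≤ ((k : ℝ) / n) ^ #S * n.choose k := by
  have := card_powersetCard_filter_superset_le (subset_univ S) (m := k) (by simpa using hk)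
  simpa using this

theorem card_edgesMeeting_le (hk : k ≤ n) (T : Finset (Fin n)) :
    (#(edgesMeeting k T) : ℝ) ≤ #T * ((k : ℝ) / n) * n.choose k := by
  have hsub : edgesMeeting k T
      ⊆ T.biUnion fun v => {e ∈ powersetCard k (univ : Finset (Fin n)) | {v} ⊆ e} := by
    intro e he
    obtain ⟨he, hd⟩ := mem_filter.1 he
    obtain ⟨v, hv, hvT⟩ := not_disjoint_iff.1 hd
    exact mem_biUnion.2 ⟨v, hvT, mem_filter.2 ⟨he, singleton_subset_iff.2 hv⟩⟩
  have h1 : (#(edgesMeeting k T) : ℝ)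
      ≤ ∑ v ∈ T, (#{e ∈ powersetCard k (univ : Finset (Fin n)) | {v} ⊆ e} : ℝ) := by
    exact_mod_cast (card_le_card hsub).trans card_biUnion_le
  refine h1.trans ((sum_le_card_nsmul _ _ _ fun v _ =>
    (card_edges_superset_le hk {v}).trans_eq (by rw [card_singleton, pow_one])).trans ?_)
  rw [nsmul_eq_mul, mul_assoc]

theorem card_edgesWithMovedPair_le (hk : k ≤ n) (π : Equiv.Perm (Fin n)) :
    (#(edgesWithMovedPair k π) : ℝ) ≤ #π.support * ((k : ℝ) / n) ^ 2 * n.choose k := by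
  have hsub : edgesWithMovedPair k π
      ⊆ π.support.biUnion fun v =>
        {e ∈ powersetCard k (univ : Finset (Fin n)) | {v, π v} ⊆ e} := by
    intro e he
    obtain ⟨he, v, hv, hve⟩ := mem_edgesWithMovedPair.1 he
    exact mem_biUnion.2 ⟨v, hv, mem_filter.2 ⟨he, hve⟩⟩
  have h1 : (#(edgesWithMovedPair k π) : ℝ) ≤ ∑ v ∈ π.support,
      (#{e ∈ powersetCard k (univ : Finset (Fin n)) | {v, π v} ⊆ e} : ℝ) := by
    exact_mod_cast (card_le_card hsub).trans card_biUnion_le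
  have h2 : ∀ v ∈ π.support,
      (#{e ∈ powersetCard k (univ : Finset (Fin n)) | {v, π v} ⊆ e} : ℝ)
        ≤ ((k : ℝ) / n) ^ 2 * n.choose k := by
    intro v hv
    have hc : #{v, π v} = 2 := card_pair (Equiv.Perm.mem_support.1 hv).symm
    have := card_edges_superset_le hk {v, π v}
    rwa [hc] at this
  refine h1.trans ((sum_le_card_nsmul _ _ _ h2).trans ?_)
  rw [nsmul_eq_mul, mul_assoc]

/-- Keeping only the square of the k-th power makes the later constants independent of k. -/
theorem card_powersetCard_compl_div_le (hk : 2 ≤ k) (hn : 0 < n) (T : Finset (Fin n)) :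
    (#(powersetCard k Tᶜ) : ℝ) / n.choose k ≤ (1 - (#T : ℝ) / n) ^ 2 := by
  have hT : #T ≤ n := by simpa using card_le_univ T
  have hn' : (0 : ℝ) < n := by exact_mod_cast hn
  have h := Nat.cast_choose_le_div_pow_mul_choose (Nat.sub_le n #T) k
  have e : ((n - #T : ℕ) : ℝ) / n = 1 - (#T : ℝ) / n := by
    rw [Nat.cast_sub hT]; field_simp
  have hb0 : (0 : ℝ) ≤ 1 - (#T : ℝ) / n := by rw [← e]; positivity
  have hb1 : 1 - (#T : ℝ) / n ≤ 1 := by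
    have : (0 : ℝ) ≤ (#T : ℝ) / n := by positivity
    linarith
  rw [e] at h
  have hcard : #(powersetCard k Tᶜ) = (n - #T).choose k := by
    rw [card_powersetCard, card_compl, Fintype.card_fin]
  rw [hcard]
  refine div_le_of_le_mul₀ (by positivity) (by positivity) (h.trans ?_)
  gcongr ?_ * _
  exact pow_le_pow_of_le_one hb0 hb1 hk

/-- Few sets of `m` hyperedges have only few members that meet `T`. -/
theorem card_filter_meeting_le (hk : 2 ≤ k) (hn : 0 < n) {c : ℝ} (hmc : (m : ℝ) = c * n)
    (T : Finset (Fin n)) :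
    (#{E ∈ powersetCard m (powersetCard k (univ : Finset (Fin n))) |
        (#(E ∩ edgesMeeting k T) : ℝ) ≤ 0.05 * (c * #T)} : ℝ)
      ≤ Real.exp (0.15 * (c * #T) - 0.95 * (c * #T) * (2 - (#T : ℝ) / n))
        * (n.choose k).choose m := by
  set Ω := powersetCard k (univ : Finset (Fin n))
  have hn' : (0 : ℝ) < n := by exact_mod_cast hn
  have hT : #T ≤ n := by simpa using card_le_univ T
  have hR : powersetCard k Tᶜ ⊆ Ω := powersetCard_mono (subset_univ _)
  -- The lower tail for hyperedges meeting T is an upper tail for those avoiding T.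
  have hsub : {E ∈ powersetCard m Ω | (#(E ∩ edgesMeeting k T) : ℝ) ≤ 0.05 * (c * #T)}
      ⊆ {E ∈ powersetCard m Ω |
        (m : ℝ) - 0.05 * (c * #T) ≤ (#(E ∩ powersetCard k Tᶜ) : ℝ)} := by
    intro E hE
    obtain ⟨hE, h⟩ := mem_filter.1 hE
    refine mem_filter.2 ⟨hE, ?_⟩
    obtain ⟨hEΩ, hEm⟩ := mem_powersetCard.1 hE
    have e1 : E ∩ powersetCard k Tᶜ = E \ edgesMeeting k T := by
      rw [← powersetCard_sdiff_edgesMeeting, ← inter_sdiff_assoc, inter_eq_left.2 hEΩ]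
    have e2 : #(E ∩ edgesMeeting k T) + #(E \ edgesMeeting k T) = m := by
      rw [card_inter_add_card_sdiff, hEm]
    rw [e1]
    have e3 : (#(E ∩ edgesMeeting k T) : ℝ) + #(E \ edgesMeeting k T) = m := by exact_mod_cast e2
    linarith
  -- With z = e³, the bound e⁻³ ≤ 0.05 yields the factor 0.95, and 3 · 0.05 yields 0.15.
  have hz : (1 : ℝ) ≤ Real.exp 3 := Real.one_le_exp (by norm_num)
  have h := card_filter_le_card_inter_le hR (m := m) (s := (m : ℝ) - 0.05 * (c * #T)) hz
  rw [show #Ω = n.choose k from card_powersetCard_univ_fin] at h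
  refine (Nat.cast_le.2 (card_le_card hsub)).trans (h.trans ?_)
  gcongr ?_ * _
  have hr := card_powersetCard_compl_div_le hk hn T
  set b : ℝ := (#T : ℝ) / n
  have hb0 : 0 ≤ b := by positivity
  have hb1 : b ≤ 1 := by rw [div_le_one hn']; exact_mod_cast hT
  have hx : c * #T = m * b := by rw [hmc]; simp only [b]; field_simp
  have he : Real.exp (-3) ≤ 0.05 := by
    have h1 : Real.exp (-3) = (Real.exp 1 ^ 3)⁻¹ := by
      rw [← Real.exp_nat_mul, Real.exp_neg]; norm_num
    rw [h1]
    have := Real.exp_one_gt_d9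
    calc (Real.exp 1 ^ 3)⁻¹ ≤ (2.718 ^ 3)⁻¹ := by gcongr; linarith
      _ ≤ 0.05 := by norm_num
  have hy : 1 + (Real.exp 3 - 1) * ((#(powersetCard k Tᶜ) : ℝ) / n.choose k)
      ≤ Real.exp (3 - 0.95 * (2 * b - b ^ 2)) := by
    have h1 : Real.exp (-3) * Real.exp 3 = 1 := by rw [← Real.exp_add]; norm_num
    have h2 := Real.add_one_le_exp (-(0.95 * (2 * b - b ^ 2)))
    have h3 : 0 ≤ 2 * b - b ^ 2 := by nlinarith
    calc _ ≤ 1 + (Real.exp 3 - 1) * (1 - b) ^ 2 := by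
          gcongr
      _ = Real.exp 3 * (1 - (1 - Real.exp (-3)) * (2 * b - b ^ 2)) := by
          linear_combination (- (2 * b - b ^ 2)) * h1
      _ ≤ Real.exp 3 * Real.exp (-(0.95 * (2 * b - b ^ 2))) := by
          gcongr; nlinarith
      _ = _ := by rw [← Real.exp_add]; congr 1
  have hy0 : 0 ≤ 1 + (Real.exp 3 - 1) * ((#(powersetCard k Tᶜ) : ℝ) / n.choose k) := by
    have : 0 ≤ Real.exp 3 - 1 := by linarith
    positivity
  calc _ ≤ Real.exp (3 - 0.95 * (2 * b - b ^ 2)) ^ m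
        * Real.exp 3 ^ (-((m : ℝ) - 0.05 * (c * #T))) := by gcongr
    _ = Real.exp (m * (3 - 0.95 * (2 * b - b ^ 2)) + 3 * (-((m : ℝ) - 0.05 * (c * #T)))) := by
        rw [← Real.exp_nat_mul, ← Real.exp_mul, ← Real.exp_add]
    _ = _ := by rw [hx]; congr 1; ring

/-- Few sets of `m` hyperedges have many members containing a pair `{v, π v}`. -/
theorem card_filter_movedPair_le (hk : 2 ≤ k) (hkn : (k : ℝ) ^ 2 ≤ n) {c : ℝ}
    (hmc : (m : ℝ) = c * n) (π : Equiv.Perm (Fin n)) :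
    (#{E ∈ powersetCard m (powersetCard k (univ : Finset (Fin n))) |
        0.01 * (c * #π.support) ≤ (#(E ∩ edgesWithMovedPair k π) : ℝ)} : ℝ)
      ≤ Real.exp (c * #π.support
          - 0.01 * (c * #π.support) * (Real.log n - 2 * Real.log k))
        * (n.choose k).choose m := by
  have hk' : (2 : ℝ) ≤ k := by exact_mod_cast hk
  have hkn' : k ≤ n := by
    have : (k : ℝ) ≤ n := by nlinarith
    exact_mod_cast this
  have hn' : (0 : ℝ) < n := by nlinarith
  have hC : (0 : ℝ) < n.choose k := by exact_mod_cast Nat.choose_pos hkn'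
  -- This z cancels the density of moved pairs: the moment factor is at most exp(ct), while
  -- z^(-0.01ct) gains a factor log n in the exponent.
  have hz : (1 : ℝ) ≤ n / k ^ 2 := by rw [one_le_div (by positivity)]; exact hkn
  have h := card_filter_le_card_inter_le (R := edgesWithMovedPair k π)
    (fun e he => (mem_edgesWithMovedPair.1 he).1) (m := m) (s := 0.01 * (c * #π.support)) hz
  rw [card_powersetCard_univ_fin] at h
  refine h.trans ?_
  gcongr ?_ * _
  have hF := card_edgesWithMovedPair_le hkn' π
  have hlog : Real.log (n / k ^ 2) = Real.log n - 2 * Real.log k := by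
    rw [Real.log_div hn'.ne' (by positivity), Real.log_pow]; norm_num
  rw [Real.rpow_def_of_pos (by positivity), hlog]
  have h1 : (n / (k : ℝ) ^ 2 - 1) * ((#(edgesWithMovedPair k π) : ℝ) / n.choose k)
      ≤ #π.support / n := by
    calc _ ≤ (n / (k : ℝ) ^ 2) * (#π.support * ((k : ℝ) / n) ^ 2) := by
          gcongr
          · linarith
          · rwa [div_le_iff₀ hC]
      _ = _ := by field_simp
  have h0 : 0 ≤ (n / (k : ℝ) ^ 2 - 1) * ((#(edgesWithMovedPair k π) : ℝ) / n.choose k) := by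
    have : 0 ≤ n / (k : ℝ) ^ 2 - 1 := by linarith
    positivity
  calc _ ≤ Real.exp (#π.support / n) ^ m * Real.exp
        ((Real.log n - 2 * Real.log k) * -(0.01 * (c * #π.support))) := by
        gcongr
        have := Real.add_one_le_exp ((#π.support : ℝ) / n)
        linarith
    _ = _ := by
        rw [← Real.exp_nat_mul, ← Real.exp_add, hmc]
        congr 1
        field_simp
        ring

theorem map_mem_powersetCard (π : Equiv.Perm (Fin n)) :
    ∀ e ∈ powersetCard k (univ : Finset (Fin n)),
      e.map π.toEmbedding ∈ powersetCard k (univ : Finset (Fin n)) := by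
  intro e he
  rw [mem_powersetCard] at he ⊢
  exact ⟨subset_univ _, by rw [card_map, he.2]⟩

/-- Few sets of `m` hyperedges contain `S` and `π S` for some `S` of size `j` disjoint from
`π S`. -/
theorem card_filter_disjoint_pair_le (hkn : k ≤ n) (hn : 0 < n) (hm : m ≤ n.choose k) {c : ℝ}
    (hmc : (m : ℝ) = c * n) (π : Equiv.Perm (Fin n)) (hx : 0 < c * #π.support) {j : ℕ}
    (hj : 0.0119 * (c * #π.support) ≤ j) :
    (#{E ∈ powersetCard m (powersetCard k (univ : Finset (Fin n))) |
        ∃ S ∈ (edgesMeeting k π.support).powersetCard j,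
          Disjoint S (S.image (map π.toEmbedding)) ∧ S ∪ S.image (map π.toEmbedding) ⊆ E} : ℝ)
      ≤ (300 * k * ((m : ℝ) / n.choose k)) ^ j * (n.choose k).choose m := by
  have h := card_filter_exists_disjoint_pair_le (edgesMeeting_subset (k := k) π.support)
    (map_injective π.toEmbedding) (map_mem_powersetCard π)
    (m := m) (by rwa [card_powersetCard_univ_fin]) j
  rw [card_powersetCard_univ_fin] at h
  refine h.trans ?_
  gcongr ?_ * _
  have hn' : (0 : ℝ) < n := by exact_mod_cast hn
  have hC : (0 : ℝ) < n.choose k := by exact_mod_cast Nat.choose_pos hkn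
  refine choose_mul_pow_le (x := c * #π.support) (by positivity) (by positivity) hx ?_ hj
  calc (#(edgesMeeting k π.support) : ℝ) * (m / n.choose k)
      ≤ (#π.support * ((k : ℝ) / n) * n.choose k) * (m / n.choose k) := by
        gcongr; exact card_edgesMeeting_le hkn _
    _ = _ := by rw [hmc]; field_simp

end Counting

/-- A permutation breaks many hyperedges, unless few hyperedges meet its support, many hyperedges
contain a pair `{v, π v}`, or many disjoint pairs `{e, π e}` are present. -/
theorem lt_card_filter_map_notMem {n k : ℕ} (H : UniformHypergraph (Fin n) k)
    (π : Equiv.Perm (Fin n)) {x : ℝ}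
    (h1 : 0.05 * x < #(H.edges ∩ edgesMeeting k π.support))
    (h2 : (#(H.edges ∩ edgesWithMovedPair k π) : ℝ) < 0.01 * x)
    (h3 : ¬ ∃ S ∈ (edgesMeeting k π.support).powersetCard ⌈0.0119 * x⌉₊,
      Disjoint S (S.image (map π.toEmbedding)) ∧ S ∪ S.image (map π.toEmbedding) ⊆ H.edges) :
    x / 240 < #{e ∈ H.edges | e.map π.toEmbedding ∉ H.edges} := by
  by_contra! hb
  set S₀ := {e ∈ H.edges ∩ edgesMeeting k π.support |
    e ∉ edgesWithMovedPair k π ∧ e.map π.toEmbedding ∈ H.edges} with hS₀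
  have cover : H.edges ∩ edgesMeeting k π.support
      ⊆ (S₀ ∪ H.edges ∩ edgesWithMovedPair k π)
        ∪ {e ∈ H.edges | e.map π.toEmbedding ∉ H.edges} := by
    intro e he
    have := (mem_inter.1 he).1
    simp only [hS₀, mem_union, mem_filter, mem_inter] at he ⊢
    tauto
  have hc : (#(H.edges ∩ edgesMeeting k π.support) : ℝ)
      ≤ #S₀ + #(H.edges ∩ edgesWithMovedPair k π)
        + #{e ∈ H.edges | e.map π.toEmbedding ∉ H.edges} := by
    exact_mod_cast (card_le_card cover).trans
      ((card_union_le _ _).trans (Nat.add_le_add_right (card_union_le _ _) _))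
  have hne : ∀ e ∈ S₀, e.map π.toEmbedding ≠ e := by
    intro e he heq
    obtain ⟨he, hF, -⟩ := mem_filter.1 he
    obtain ⟨-, heM⟩ := mem_inter.1 he
    obtain ⟨heΩ, hd⟩ := mem_filter.1 heM
    obtain ⟨v, hv, hvT⟩ := not_disjoint_iff.1 hd
    refine hF (mem_edgesWithMovedPair.2 ⟨heΩ, v, hvT, ?_⟩)
    have : π v ∈ e := by
      rw [← heq]; exact mem_map_of_mem π.toEmbedding hv
    simp [insert_subset_iff, hv, this]
  obtain ⟨S, hSS₀, hcard, hdis⟩ :=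
    exists_subset_disjoint_image (map_injective π.toEmbedding) S₀ hne
  have hcard' : (#S₀ : ℝ) ≤ 3 * #S := by exact_mod_cast hcard
  have hx : 0 < x := by
    have : (0 : ℝ) ≤ #(H.edges ∩ edgesWithMovedPair k π) := by positivity
    linarith
  -- The constants fit since 0.05 - 0.01 - 1/240 > 3 · 0.0119.
  obtain ⟨S', hS'S, hS'c⟩ := exists_subset_card_eq (s := S) (n := ⌈0.0119 * x⌉₊)
    (Nat.ceil_le.2 (by linarith))
  have hsub := hS'S.trans hSS₀
  refine h3 ⟨S', mem_powersetCard.2 ⟨fun e he => ?_, hS'c⟩, ?_, ?_⟩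
  · exact (mem_inter.1 (mem_filter.1 (hsub he)).1).2
  · exact hdis.mono hS'S (image_subset_image hS'S)
  · refine union_subset (fun e he => (mem_inter.1 (mem_filter.1 (hsub he)).1).1) ?_
    exact image_subset_iff.2 fun e he => (mem_filter.1 (hsub he)).2.2

/-- β enters only through t ≥ βn, whence ct/240 ≥ βm/240. The bound β ≥ 1/n gives t ≥ 1, hence t ≥
2, as no permutation moves exactly one point. -/
theorem isAsymmetric_of_forall_lt {n k : ℕ} (H : UniformHypergraph (Fin n) k) {c β : ℝ}
    (hn : 0 < n) (hc : 0 < c) (hm : (#H.edges : ℝ) = c * n) (hβ : 1 / (n : ℝ) ≤ β)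
    (hβ' : Real.exp (-c / 6) ≤ β)
    (h : ∀ π : Equiv.Perm (Fin n), 2 ≤ #π.support → n * Real.exp (-c / 6) ≤ #π.support →
      c * #π.support / 240 < #{e ∈ H.edges | e.map π.toEmbedding ∉ H.edges}) :
    H.IsAsymmetric β (β / 240) := by
  intro π hπ
  have hn' : (0 : ℝ) < n := by exact_mod_cast hn
  have hsum : #{v | π v = v} + #π.support = n := by
    have := card_filter_add_card_filter_not (s := (univ : Finset (Fin n))) (fun v => π v = v)
    simpa [Equiv.Perm.support] using this
  have hsum' : (#{v | π v = v} : ℝ) + #π.support = n := by exact_mod_cast hsum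
  rw [Fintype.card_fin] at hπ
  have ht : β * n ≤ #π.support := by linarith
  have ht1 : (1 : ℝ) ≤ #π.support := by
    refine le_trans ?_ ht
    rwa [div_le_iff₀ hn'] at hβ
  have ht1' : 1 ≤ #π.support := by exact_mod_cast ht1
  have ht2 : 2 ≤ #π.support := by
    have := Equiv.Perm.card_support_ne_one π
    omega
  have hb := h π ht2 (le_trans (by rw [mul_comm]; gcongr) ht)
  have hE : (#{e ∈ H.edges | e.map π.toEmbedding ∈ H.edges} : ℝ)
      + #{e ∈ H.edges | e.map π.toEmbedding ∉ H.edges} = c * n := by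
    rw [← hm]
    exact_mod_cast card_filter_add_card_filter_not (s := H.edges) _
  rw [aut, gi, max_self, hm, div_lt_iff₀ (by positivity)]
  have : c * (β * n) / 240 ≤ c * #π.support / 240 := by gcongr
  linarith

end UniformHypergraph

/-! ### The union bound and the choice of constants -/

namespace UniformHypergraph

theorem sum_finset_fin_le {n : ℕ} (q : ℕ → ℝ) {a : ℝ}
    (h : ∀ t ≤ n, (n.choose t : ℝ) * q t ≤ a) :
    ∑ T : Finset (Fin n), q #T ≤ (n + 1) * a := by
  rw [← powerset_univ, sum_powerset_apply_card, card_univ, Fintype.card_fin]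
  have := sum_le_card_nsmul (range (n + 1)) (fun t => n.choose t • q t) a fun t ht => by
    rw [nsmul_eq_mul]
    exact h t (by simpa [Nat.lt_succ_iff] using ht)
  simpa using this

theorem sum_perm_fin_le {n : ℕ} (q : ℕ → ℝ) (hq : ∀ t, 0 ≤ q t) {a : ℝ}
    (h : ∀ t ≤ n, (n : ℝ) ^ t * q t ≤ a) :
    ∑ π : Equiv.Perm (Fin n), q #π.support ≤ (n + 1) * a := by
  have hmaps : ∀ π ∈ (univ : Finset (Equiv.Perm (Fin n))), #π.support ∈ range (n + 1) := by
    intro π _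
    have : #π.support ≤ n := by simpa using card_le_univ π.support
    simpa [Nat.lt_succ_iff] using this
  rw [← sum_fiberwise_of_maps_to hmaps]
  have := sum_le_card_nsmul (range (n + 1))
    (fun t => ∑ π : Equiv.Perm (Fin n) with #π.support = t, q #π.support) a fun t ht => by
    have e : ∑ π : Equiv.Perm (Fin n) with #π.support = t, q #π.support
        = #{π : Equiv.Perm (Fin n) | #π.support = t} * q t := by
      rw [sum_congr rfl fun π hπ => by rw [(mem_filter.1 hπ).2], sum_const, nsmul_eq_mul]
    rw [e]
    refine le_trans ?_ (h t (by simpa [Nat.lt_succ_iff] using ht))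
    have : (#{π : Equiv.Perm (Fin n) | #π.support = t} : ℝ) ≤ (n : ℝ) ^ t := by
      exact_mod_cast Equiv.Perm.card_filter_card_support_eq_le n t
    exact mul_le_mul_of_nonneg_right this (hq t)
  simpa using this

/-- The asymptotic conditions on `n` used in the union bound. -/
theorem exists_threshold (k : ℕ) : ∃ N : ℕ, ∀ n : ℕ, N ≤ n →
    400 ≤ Real.log n ∧ (10 : ℝ) ^ 4 ≤ n ∧ (k : ℝ) ^ 4 ≤ n ∧
      240000 * (k : ℝ) ^ 3 * Real.log n ≤ Real.exp (Real.log n / 2) := by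
  have h1 : Filter.Tendsto (fun n : ℕ => (n : ℝ)) Filter.atTop Filter.atTop :=
    tendsto_natCast_atTop_atTop
  have h2 : Filter.Tendsto (fun n : ℕ => Real.log n) Filter.atTop Filter.atTop :=
    Real.tendsto_log_atTop.comp h1
  -- Use exp(u)/u → ∞ at u = (log n)/2; the halving turns 480000 into 240000.
  have h3 := ((Real.tendsto_exp_div_pow_atTop 1).comp
    (h2.atTop_div_const (show (0 : ℝ) < 2 by norm_num))).eventually_ge_atTop
      (480000 * (k : ℝ) ^ 3)
  refine Filter.eventually_atTop.1 ?_
  filter_upwards [h2.eventually_ge_atTop 400, h1.eventually_ge_atTop (10 ^ 4),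
    h1.eventually_ge_atTop ((k : ℝ) ^ 4), h3] with n a b c d
  refine ⟨a, b, c, ?_⟩
  simp only [Function.comp_apply, pow_one] at d
  rw [le_div_iff₀ (by linarith)] at d
  linarith

/-- In the sparse range, C(n,k) ≥ (n/k)² bounds the density by ck²/n, which is of order (log n)/n;
n^(1/2) absorbs the logarithm and the constant 300 · 800 · k³. -/
theorem le_exp_neg_half_log {n k m : ℕ} (hk : 2 ≤ k) (hkn : k ≤ n) {c : ℝ} (hc : 0 ≤ c)
    (hmc : (m : ℝ) = c * n)
    (hL : 240000 * (k : ℝ) ^ 3 * Real.log n ≤ Real.exp (Real.log n / 2))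
    (hcL : c < 800 * Real.log n) :
    300 * k * ((m : ℝ) / n.choose k) ≤ Real.exp (-(Real.log n / 2)) := by
  have hn : 0 < n := by omega
  have hn' : (0 : ℝ) < n := by exact_mod_cast hn
  have hk' : (0 : ℝ) < k := by exact_mod_cast (by omega : 0 < k)
  have hC : (0 : ℝ) < n.choose k := by exact_mod_cast Nat.choose_pos hkn
  have h1 : (n : ℝ) ^ 2 ≤ k ^ 2 * n.choose k := by
    have h := Nat.cast_choose_le_div_pow_mul_choose hkn k
    rw [Nat.choose_self, Nat.cast_one] at h
    have h2 : ((k : ℝ) / n) ^ k ≤ ((k : ℝ) / n) ^ 2 :=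
      pow_le_pow_of_le_one (by positivity)
        (by rw [div_le_one hn']; exact_mod_cast hkn) hk
    have h3 : 1 ≤ ((k : ℝ) / n) ^ 2 * n.choose k := h.trans (by gcongr)
    rw [div_pow, div_mul_eq_mul_div, one_le_div (by positivity)] at h3
    exact h3
  have h2 : (m : ℝ) / n.choose k ≤ c * k ^ 2 / n := by
    rw [div_le_div_iff₀ hC hn', hmc]
    nlinarith
  have he : Real.exp (-(Real.log n / 2)) * n = Real.exp (Real.log n / 2) := by
    nth_rewrite 2 [← Real.exp_log hn']
    rw [← Real.exp_add]; congr 1; ring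
  calc 300 * k * ((m : ℝ) / n.choose k) ≤ 300 * k * (c * k ^ 2 / n) := by gcongr
    _ ≤ 300 * k * ((800 * Real.log n) * k ^ 2 / n) := by gcongr
    _ = (240000 * (k : ℝ) ^ 3 * Real.log n) / n := by ring
    _ ≤ Real.exp (Real.log n / 2) / n := by gcongr
    _ = _ := by rw [← he]; field_simp

open Classical in
theorem card_filter_not_isAsymmetric_le {n k m : ℕ} (hk : 2 ≤ k) {c κ : ℝ}
    (hκ : 10 ^ 4 ≤ κ) (hκk : 900 * (k : ℝ) ≤ κ ^ 3)
    (hL : 400 ≤ Real.log n) (hn4 : (10 : ℝ) ^ 4 ≤ n) (hkn4 : (k : ℝ) ^ 4 ≤ n)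
    (hLk : 240000 * (k : ℝ) ^ 3 * Real.log n ≤ Real.exp (Real.log n / 2))
    (hm : m ≤ n.choose k) (hmc : (m : ℝ) = c * n) (hc : κ ≤ c)
    (hmκ : (m : ℝ) ≤ (n.choose k : ℝ) / κ ^ 3) :
    (#{H ∈ withEdges n k m | ¬ ∀ β : ℝ, max (Real.exp (-c / 6)) (1 / (n : ℝ)) ≤ β → β ≤ 1 →
        H.IsAsymmetric β (β / 240)} : ℝ) ≤ 1 / (n : ℝ) ^ 15 * #(withEdges n k m) := by
  have hk' : (2 : ℝ) ≤ k := by exact_mod_cast hk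
  have hkn2 : (k : ℝ) ^ 2 ≤ n := (pow_le_pow_right₀ (by linarith) (by norm_num)).trans hkn4
  have hkn : k ≤ n := by
    have : (k : ℝ) ≤ n := by nlinarith
    exact_mod_cast this
  have hn' : (0 : ℝ) < n := by linarith
  have hn : 0 < n := by exact_mod_cast hn'
  have hC : (0 : ℝ) < n.choose k := by exact_mod_cast Nat.choose_pos hkn
  have hc4 : (10 : ℝ) ^ 4 ≤ c := hκ.trans hc
  have hc0 : 0 < c := by linarith
  have hlogk : Real.log k ≤ Real.log n / 4 := by
    have := Real.log_le_log (by positivity) hkn4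
    rw [Real.log_pow] at this
    push_cast at this
    linarith
  rw [card_withEdges]
  set M : ℝ := ((n.choose k).choose m : ℝ)
  set L := Real.log n
  set X := powersetCard m (powersetCard k (univ : Finset (Fin n)))
  -- `B₁` is indexed by supports, the other two families by permutations. Event (1) is needed, and
  -- controlled, only for supports in the range forced by β*.
  let q₁ : ℕ → ℝ := fun t => if 2 ≤ t ∧ n * Real.exp (-c / 6) ≤ t then
    Real.exp (0.15 * (c * t) - 0.95 * (c * t) * (2 - t / n)) else 0
  let q₂ : ℕ → ℝ := fun t => Real.exp (-((t + 17) * L))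
  let B₁ : Finset (Fin n) → Finset (Finset (Finset (Fin n))) := fun T =>
    {E ∈ X | (2 ≤ #T ∧ n * Real.exp (-c / 6) ≤ #T) ∧
      (#(E ∩ edgesMeeting k T) : ℝ) ≤ 0.05 * (c * #T)}
  let B₂ : Equiv.Perm (Fin n) → Finset (Finset (Finset (Fin n))) := fun π =>
    {E ∈ X | 2 ≤ #π.support ∧
      0.01 * (c * #π.support) ≤ (#(E ∩ edgesWithMovedPair k π) : ℝ)}
  let B₃ : Equiv.Perm (Fin n) → Finset (Finset (Finset (Fin n))) := fun π =>
    {E ∈ X | 2 ≤ #π.support ∧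
      ∃ S ∈ (edgesMeeting k π.support).powersetCard ⌈0.0119 * (c * #π.support)⌉₊,
        Disjoint S (S.image (map π.toEmbedding)) ∧ S ∪ S.image (map π.toEmbedding) ⊆ E}
  have hB₁ : ∀ T, (#(B₁ T) : ℝ) ≤ q₁ #T * M := by
    intro T
    by_cases h : 2 ≤ #T ∧ n * Real.exp (-c / 6) ≤ #T
    · simp only [B₁, q₁, if_pos h]
      simp only [h, and_self, true_and]
      convert card_filter_meeting_le hk hn hmc T using 1
    · simp [B₁, q₁, if_neg h, h]
  have hB₂ : ∀ π, (#(B₂ π) : ℝ) ≤ q₂ #π.support * M := by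
    intro π
    by_cases h : 2 ≤ #π.support
    · simp only [B₂, h, true_and]
      have h2 : (2 : ℝ) ≤ #π.support := by exact_mod_cast h
      refine le_trans ?_ ((card_filter_movedPair_le hk hkn2 hmc π).trans ?_)
      · apply le_of_eq; congr!
      · gcongr
        exact Real.exp_le_exp.2 (mul_sub_log_le_neg_log hL hlogk hc4 h2)
    · simp only [B₂, h, false_and, filter_false, card_empty, Nat.cast_zero]
      positivity
  -- The hypothesis 900k ≤ κ³ makes this at most 1/3 < 1/e.
  have hy1 : 300 * k * ((m : ℝ) / n.choose k) ≤ Real.exp (-1) := by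
    have hκ3 : 0 < κ ^ 3 := by positivity
    have h1 : (m : ℝ) / n.choose k ≤ 1 / κ ^ 3 := by
      rw [div_le_iff₀ hC]
      exact hmκ.trans_eq (by ring)
    calc 300 * k * ((m : ℝ) / n.choose k) ≤ 300 * k * (1 / κ ^ 3) := by gcongr
      _ ≤ 3⁻¹ := by
        rw [mul_one_div, div_le_iff₀ hκ3]; linarith
      _ ≤ Real.exp (-1) := by
        rw [Real.exp_neg]
        gcongr
        have := Real.exp_one_lt_d9
        linarith
  have hB₃ : ∀ π, (#(B₃ π) : ℝ) ≤ q₂ #π.support * M := by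
    intro π
    by_cases h : 2 ≤ #π.support
    · simp only [B₃, h, true_and]
      have h2 : (2 : ℝ) ≤ #π.support := by exact_mod_cast h
      refine le_trans ?_ ((card_filter_disjoint_pair_le hkn hn hm hmc π (by positivity)
        (Nat.le_ceil _)).trans ?_)
      · apply le_of_eq; congr!
      · gcongr
        exact pow_le_exp_neg_log (by linarith) hc4 h2 (Nat.le_ceil _) (by positivity) hy1
          fun h => le_exp_neg_half_log hk hkn hc0.le hmc hLk h
    · simp only [B₃, h, false_and, filter_false, card_empty, Nat.cast_zero]
      positivity
  have hexp : ∀ a : ℕ, Real.exp (a * L) = (n : ℝ) ^ a := fun a => by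
    rw [Real.exp_nat_mul, Real.exp_log hn']
  have hS₁ : ∑ T : Finset (Fin n), q₁ #T ≤ (n + 1) * Real.exp (-(17 * L)) := by
    refine sum_finset_fin_le q₁ fun t ht => ?_
    simp only [q₁]
    split_ifs with h
    · exact choose_mul_exp_le_exp_neg_log (by linarith) hn4 hc4 h.1 ht h.2
    · rw [mul_zero]; positivity
  have hS₂ : ∑ π : Equiv.Perm (Fin n), q₂ #π.support ≤ (n + 1) * Real.exp (-(17 * L)) := by
    refine sum_perm_fin_le q₂ (fun t => (Real.exp_pos _).le) fun t _ => ?_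
    rw [← hexp, ← Real.exp_add]
    apply le_of_eq; congr 1; ring
  have hinj : #{H ∈ withEdges n k m | ¬ ∀ β : ℝ, max (Real.exp (-c / 6)) (1 / (n : ℝ)) ≤ β →
      β ≤ 1 → H.IsAsymmetric β (β / 240)}
      ≤ #(univ.biUnion B₁ ∪ (univ.biUnion B₂ ∪ univ.biUnion B₃)) := by
    refine card_le_card_of_injOn UniformHypergraph.edges ?_
      fun _ _ _ _ h => UniformHypergraph.ext h
    intro H hH
    obtain ⟨hHm, hH⟩ := mem_filter.1 hH
    have hHm := mem_withEdges.1 hHm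
    by_contra hcon
    have hHX : H.edges ∈ X := mem_powersetCard.2
      ⟨fun e he => mem_powersetCard.2 ⟨subset_univ _, H.uniform e he⟩, hHm⟩
    simp only [coe_union, Set.mem_union, mem_coe, mem_biUnion, mem_univ, true_and, not_or,
      not_exists, B₁, B₂, B₃, mem_filter, hHX, not_and, not_le] at hcon
    obtain ⟨h1, h2, h3⟩ := hcon
    refine hH fun β hβ _ => H.isAsymmetric_of_forall_lt hn hc0 (by rw [hHm, hmc])
      ((le_max_right _ _).trans hβ) ((le_max_left _ _).trans hβ) fun π hπ hπ' => ?_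
    refine H.lt_card_filter_map_notMem π (h1 _ ⟨hπ, hπ'⟩) (h2 π hπ) ?_
    rintro ⟨S, hS, hd, hSE⟩
    exact h3 π hπ S hS hd hSE
  have hcard : (#(univ.biUnion B₁ ∪ (univ.biUnion B₂ ∪ univ.biUnion B₃)) : ℝ)
      ≤ ∑ T, (#(B₁ T) : ℝ) + (∑ π, (#(B₂ π) : ℝ) + ∑ π, (#(B₃ π) : ℝ)) := by
    exact_mod_cast (card_union_le _ _).trans (Nat.add_le_add card_biUnion_le
      ((card_union_le _ _).trans (Nat.add_le_add card_biUnion_le card_biUnion_le)))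
  have hM : 0 ≤ M := by positivity
  have t₁ : ∑ T, (#(B₁ T) : ℝ) ≤ (n + 1) * Real.exp (-(17 * L)) * M :=
    (sum_le_sum fun T _ => hB₁ T).trans (by rw [← sum_mul]; gcongr)
  have t₂ : ∑ π, (#(B₂ π) : ℝ) ≤ (n + 1) * Real.exp (-(17 * L)) * M :=
    (sum_le_sum fun T _ => hB₂ T).trans (by rw [← sum_mul]; gcongr)
  have t₃ : ∑ π, (#(B₃ π) : ℝ) ≤ (n + 1) * Real.exp (-(17 * L)) * M :=
    (sum_le_sum fun T _ => hB₃ T).trans (by rw [← sum_mul]; gcongr)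
  -- Three events, n + 1 support sizes, n^(-17) each; and 3(n + 1) ≤ n².
  have hfin : 3 * ((n + 1) * Real.exp (-(17 * L))) ≤ 1 / (n : ℝ) ^ 15 := by
    have h17 := hexp 17
    push_cast at h17
    rw [Real.exp_neg, h17, ← mul_assoc, ← div_eq_mul_inv,
      div_le_div_iff₀ (by positivity) (by positivity)]
    have : (n : ℝ) ^ 17 = n ^ 2 * n ^ 15 := by ring
    rw [this, one_mul]
    gcongr
    nlinarith
  calc _ ≤ (#(univ.biUnion B₁ ∪ (univ.biUnion B₂ ∪ univ.biUnion B₃)) : ℝ) := by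
        exact_mod_cast hinj
    _ ≤ 3 * ((n + 1) * Real.exp (-(17 * L))) * M := by linarith
    _ ≤ _ := by gcongr

/-- For `k ≥ 2` every sufficiently large constant is admissible. -/
theorem isRobustAsymmetryConstant {k : ℕ} (hk : 2 ≤ k) {κ : ℝ} (hκ : 10 ^ 4 ≤ κ)
    (hκk : 900 * (k : ℝ) ≤ κ ^ 3) : IsRobustAsymmetryConstant k κ := by
  classical
  obtain ⟨N, hN⟩ := exists_threshold k
  refine ⟨N, fun n hn c m hm hmc hc hmκ => ?_⟩
  obtain ⟨hL, hn4, hkn4, hLk⟩ := hN n hn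
  have h := card_filter_not_isAsymmetric_le hk hκ hκk hL hn4 hkn4 hLk hm hmc hc hmκ
  have hpos : (0 : ℝ) < #(withEdges n k m) := by
    exact_mod_cast card_pos.2 (withEdges_nonempty hm)
  rw [randomHypergraph, PMF.toOuterMeasure_uniformOfFinset_apply]
  simp only [Set.mem_ofPred_eq]
  set P : UniformHypergraph (Fin n) k → Prop := fun H =>
    ∀ β : ℝ, max (Real.exp (-c / 6)) (1 / (n : ℝ)) ≤ β → β ≤ 1 → H.IsAsymmetric β (β / 240)
  have hsum : (#{H ∈ withEdges n k m | P H} : ℝ) + #{H ∈ withEdges n k m | ¬ P H}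
      = #(withEdges n k m) := by
    exact_mod_cast card_filter_add_card_filter_not (s := withEdges n k m) P
  have key : 1 - 1 / (n : ℝ) ^ 15
      ≤ (#{H ∈ withEdges n k m | P H} : ℝ) / #(withEdges n k m) := by
    rw [le_div_iff₀ hpos]
    linarith
  refine (ENNReal.ofReal_le_ofReal key).trans (le_of_eq ?_)
  rw [ENNReal.ofReal_div_of_pos hpos, ENNReal.ofReal_natCast, ENNReal.ofReal_natCast]

/-- For `k ≤ 1` there is no hypergraph with the required number of hyperedges. -/
theorem isRobustAsymmetryConstant_of_le_one {k : ℕ} (hk : k ≤ 1) :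
    IsRobustAsymmetryConstant k 2 := by
  refine ⟨1, fun n hn c m hm hmc hc hmκ => ?_⟩
  have hn' : (1 : ℝ) ≤ n := by exact_mod_cast hn
  -- Hence m ≤ n/8, contradicting m ≥ 2n.
  have h1 : (n.choose k : ℝ) ≤ n := by
    interval_cases k <;> simp [hn']
  have h2 : 2 * (n : ℝ) ≤ c * n := by gcongr
  have h3 : (n.choose k : ℝ) / 2 ^ 3 ≤ n / 2 ^ 3 := by gcongr
  linarith

end UniformHypergraph

theorem mainTheorem4 :
    (∀ k : ℕ, ∃ κ : ℝ, 0 < κ ∧ UniformHypergraph.IsRobustAsymmetryConstant k κ) ∧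
      UniformHypergraph.IsRobustAsymmetryConstant 3 (10 ^ 4) := by
  refine ⟨fun k => ?_, ?_⟩
  · by_cases hk : 2 ≤ k
    · have hk' : (2 : ℝ) ≤ k := by exact_mod_cast hk
      -- The factor k secures 900k ≤ κ³ for every k.
      refine ⟨10 ^ 4 * k, by positivity,
        UniformHypergraph.isRobustAsymmetryConstant hk (by linarith) ?_⟩
      rw [mul_pow]
      have : (k : ℝ) ≤ k ^ 3 := le_self_pow₀ (by linarith) (by norm_num)
      linarith
    · exact ⟨2, by norm_num,
        UniformHypergraph.isRobustAsymmetryConstant_of_le_one (by omega)⟩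
  · exact UniformHypergraph.isRobustAsymmetryConstant (by norm_num) le_rfl (by norm_num)
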